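/- Definitions. Let $\mu,\nu$ be probability measures on a measurable space $\Omega$ (a metric space $\Omega$ carries its Borel $\sigma$-algebra); let $f,g$ be their densities with respect to a dominating measure $\lambda$ (for instance $\lambda=\mu+\nu$), and on $\mathbb R$ let $F,G$ be their distribution functions. Put - Lévy (on $\mathbb R$): $d_L(\mu,\nu)=\inf\{\epsilon>0: G(x-\epsilon)-\epsilon\le F(x)\le G(x+\epsilon)+\epsilon\ \ \forall x\in\mathbb R\}$; - Kolmogorov (on $\mathbb R$): $d_K(\mu,\nu)=\sup_{x\in\mathbb R}|F(x)-G(x)|$; - discrepancy (metric spaces): $d_D(\mu,\nu)=\sup_B|\mu(B)-\nu(B)|$ over all closed balls $B$; - Prokhorov (metric spaces): $d_P(\mu,\nu)=\inf\{\epsilon>0:\mu(B)\le\nu(B^\epsilon)+\epsilon \text{ for all Borel } B\}$, where $B^\epsilon=\{x:\inf_{y\in B}d(x,y)\le\epsilon\}$; - Wasserstein/Kantorovich (metric spaces): $d_W(\mu,\nu)=\sup\left|\int h\,d\mu-\int h\,d\nu\right|\in[0,\infty]$ over all $h:\Omega\to\mathbb R$ with $|h(x)-h(y)|\le d(x,y)$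 that are integrable for $\mu$ and $\nu$; - total variation: $d_{TV}(\mu,\nu)=\sup_A|\mu(A)-\nu(A)|$ over all measurable $A$; - Hellinger: $d_H(\mu,\nu)=\left(\int(\sqrt f-\sqrt g)^2\,d\lambda\right)^{1/2}$; - relative entropy: $d_I(\mu,\nu)=\int_{\{f>0\}} f\log(f/g)\,d\lambda\in[0,\infty]$; - $\chi^2$-distance: $d_{\chi^2}(\mu,\nu)=\int_{\{f>0\}\cup\{g>0\}}(f-g)^2/g\,d\lambda\in[0,\infty]$ (with $c/0=\infty$ for $c>0$); - separation (countable $\Omega$): $d_S(\mu,\nu)=\sup_{i:\,\nu(i)>0}\left(1-\mu(i)/\nu(i)\right)$. Say that $d$ *metrizes weak convergence* on $\Omega$ if $d$ is a metric on the set of probability measures on $\Omega$ whose topology is the topology of weak convergence, and that $d$-convergence *implies weak convergence* if, for all probability measures $\mu_n,\nu$ on $\Omega$, $d(\mu_n,\nu)\to0$ implies $\mu_n\to\nu$ weakly. **Theorem.** 1. On $\mathbb R$, the Lévy metric metrizes weak convergence. Convergence under the discrepancy metric and convergence under the Kolmogorov metric each imply weak convergence. If $\nu$ is absolutely continuous with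 respect to Lebesgue measure, then for every sequence $(\mu_n)$ of probability measures on $\mathbb R$: $\mu_n\to\nu$ weakly $\iff d_D(\mu_n,\nu)\to0 \iff d_K(\mu_n,\nu)\to 0$. 2. On every separable metric space the Prokhorov metric metrizes weak convergence. On every metric space convergence under the Wasserstein metric implies weak convergence. 3. Let $\Omega$ be a bounded metric space. If $\Omega$ is separable, the Wasserstein metric metrizes weak convergence. Convergence under any of the following implies weak convergence: total variation, Hellinger, separation (for countable $\Omega$), relative entropy, and the $\chi^2$-distance. For the last three, which are not symmetric, this holds for both orders of the arguments: $d(\mu_n,\nu)\to0$ implies $\mu_n\to\nu$ weakly, and so does $d(\nu,\mu_n)\to0$. 4. If $\Omega$ is a bounded and finite metric space, then the total variation metric and the Hellinger metric both metrize weak convergence. -/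

import Mathlib

open MeasureTheory ProbabilityTheory Filter Topology
open scoped ENNReal

/-! Distances between probability measures.  All of them take values in `[0, ∞]`; the suprema and
infima below are therefore never junk values. -/

namespace ProbMetric

noncomputable section

/-- Lévy distance on `ℝ`:
`inf {ε > 0 : G (x - ε) - ε ≤ F x ≤ G (x + ε) + ε for all x}`, with `F`, `G` the distribution
functions of `μ`, `ν`.  The set contains `1`. -/
def levy (μ ν : ProbabilityMeasure ℝ) : ℝ≥0∞ :=
  ENNReal.ofReal (sInf {ε : ℝ | 0 < ε ∧ ∀ x : ℝ,
    cdf (ν : Measure ℝ) (x - ε) - ε ≤ cdf (μ : Measure ℝ) x ∧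
    cdf (μ : Measure ℝ) x ≤ cdf (ν : Measure ℝ) (x + ε) + ε})

/-- Kolmogorov (uniform) distance on `ℝ`: `sup_x |F x - G x|`. -/
def kolmogorov (μ ν : ProbabilityMeasure ℝ) : ℝ≥0∞ :=
  ⨆ x : ℝ, ENNReal.ofReal |cdf (μ : Measure ℝ) x - cdf (ν : Measure ℝ) x|

section MetricSpaces

variable {Ω : Type*} [MetricSpace Ω] [MeasurableSpace Ω]

/-- Discrepancy: supremum of `|μ B - ν B|` over all closed balls `B`. -/
def discrepancy (μ ν : ProbabilityMeasure Ω) : ℝ≥0∞ :=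
  ⨆ (x : Ω) (r : ℝ) (_ : 0 ≤ r), ENNReal.ofReal
    |(μ : Measure Ω).real (Metric.closedBall x r) - (ν : Measure Ω).real (Metric.closedBall x r)|

/-- Prokhorov distance: `inf {ε > 0 : μ B ≤ ν (B^ε) + ε for all Borel sets B}`, where
`B^ε = {x : inf_{y ∈ B} d(x, y) ≤ ε}`.  The set contains `1`. -/
def prokhorov (μ ν : ProbabilityMeasure Ω) : ℝ≥0∞ :=
  ENNReal.ofReal (sInf {ε : ℝ | 0 < ε ∧ ∀ B : Set Ω, MeasurableSet B →
    (μ : Measure Ω) B ≤ (ν : Measure Ω) (Metric.cthickening ε B) + ENNReal.ofReal ε})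

/-- Wasserstein (Kantorovich) distance: supremum of `|∫ h dμ - ∫ h dν|` over all functions `h`
with `|h x - h y| ≤ d(x, y)` for which both integrals exist. -/
def wasserstein (μ ν : ProbabilityMeasure Ω) : ℝ≥0∞ :=
  ⨆ (h : Ω → ℝ) (_ : ∀ x y, |h x - h y| ≤ dist x y)
    (_ : Integrable h (μ : Measure Ω)) (_ : Integrable h (ν : Measure Ω)),
    ENNReal.ofReal |∫ x, h x ∂(μ : Measure Ω) - ∫ x, h x ∂(ν : Measure Ω)|

end MetricSpaces

section MeasurableSpaces

variable {Ω : Type*} [MeasurableSpace Ω]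

/-- Total variation distance: supremum of `|μ A - ν A|` over all measurable sets `A`. -/
def totalVariation (μ ν : ProbabilityMeasure Ω) : ℝ≥0∞ :=
  ⨆ (A : Set Ω) (_ : MeasurableSet A),
    ENNReal.ofReal |(μ : Measure Ω).real A - (ν : Measure Ω).real A|

/-- A measure dominating both `μ` and `ν`, with respect to which densities are taken. -/
def dominating (μ ν : ProbabilityMeasure Ω) : Measure Ω := (μ : Measure Ω) + (ν : Measure Ω)

/-- Hellinger distance: `(∫ (√f - √g)² dλ)^(1/2)`, with `f`, `g` the densities of `μ`, `ν` with
respect to the dominating measure `λ`. -/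
def hellinger (μ ν : ProbabilityMeasure Ω) : ℝ≥0∞ :=
  (∫⁻ x, ENNReal.ofReal
    ((√((μ : Measure Ω).rnDeriv (dominating μ ν) x).toReal -
      √((ν : Measure Ω).rnDeriv (dominating μ ν) x).toReal) ^ 2) ∂(dominating μ ν)) ^ (1 / 2 : ℝ)

/-- Chi-square distance: `∫ (f - g)² / g dλ`, with `f`, `g` the densities of `μ`, `ν` with respect
to the dominating measure `λ`.  The quotient is taken in `[0, ∞]`: it is `∞` where `g = 0 < f`,
and it is `0` where `f = g = 0`, that is, outside the union of the supports. -/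
def chiSquare (μ ν : ProbabilityMeasure Ω) : ℝ≥0∞ :=
  ∫⁻ x, ENNReal.ofReal
    ((((μ : Measure Ω).rnDeriv (dominating μ ν) x).toReal -
      ((ν : Measure Ω).rnDeriv (dominating μ ν) x).toReal) ^ 2) /
      (ν : Measure Ω).rnDeriv (dominating μ ν) x ∂(dominating μ ν)

/-- Relative entropy `∫ f log (f / g) dλ`; it is `∞` if `μ` is not dominated by `ν`. -/
def relativeEntropy (μ ν : ProbabilityMeasure Ω) : ℝ≥0∞ :=
  InformationTheory.klDiv (μ : Measure Ω) (ν : Measure Ω)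

/-- Separation distance, used on countable spaces: supremum of `1 - μ i / ν i` over the points `i`
with `ν i > 0`.  The subtraction in `[0, ∞]` truncates negative values to `0`, which does not change
the supremum because `μ i ≤ ν i` for some `i` with `ν i > 0`. -/
def separation (μ ν : ProbabilityMeasure Ω) : ℝ≥0∞ :=
  ⨆ (i : Ω) (_ : (ν : Measure Ω) {i} ≠ 0), (1 - (μ : Measure Ω) {i} / (ν : Measure Ω) {i})

end MeasurableSpaces

section WeakConvergence

variable {Ω : Type*} [MetricSpace Ω] [MeasurableSpace Ω] [BorelSpace Ω]

/-- `d` metrizes weak convergence: `d` is a (finite) metric on the probability measures on `Ω`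
and the topology of this metric is the topology of weak convergence. -/
def MetrizesWeak (d : ProbabilityMeasure Ω → ProbabilityMeasure Ω → ℝ≥0∞) : Prop :=
  ∃ m : MetricSpace (ProbabilityMeasure Ω),
    (∀ μ ν, d μ ν = ENNReal.ofReal (m.dist μ ν)) ∧
    m.toUniformSpace.toTopologicalSpace =
      ProbabilityMeasure.instTopologicalSpace (Ω := Ω)

/-- `d (μ n) ν → 0` implies that `μ n` converges weakly to `ν`. -/
def ImpliesWeak (d : ProbabilityMeasure Ω → ProbabilityMeasure Ω → ℝ≥0∞) : Prop :=
  ∀ (μ : ℕ → ProbabilityMeasure Ω) (ν : ProbabilityMeasure Ω),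
    Tendsto (fun n => d (μ n) ν) atTop (𝓝 0) → Tendsto μ atTop (𝓝 ν)

/-- For sequences with limit `ν`, weak convergence and `d`-convergence are the same. -/
def MetrizesWeakAt (d : ProbabilityMeasure Ω → ProbabilityMeasure Ω → ℝ≥0∞)
    (ν : ProbabilityMeasure Ω) : Prop :=
  ∀ μ : ℕ → ProbabilityMeasure Ω,
    Tendsto μ atTop (𝓝 ν) ↔ Tendsto (fun n => d (μ n) ν) atTop (𝓝 0)

end WeakConvergence

end

end ProbMetric

/-!
Each implication follows from an inequality `d ≤ φ ∘ d'` between two distances, where `φ` tends to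
`0` at `0`: `d'`-convergence then implies `d`-convergence.

* Writing both measures through densities, `‖f - g‖₁ ≤ ‖√f - √g‖₂ ‖√f + √g‖₂` gives
  `d_TV ≤ d_H`, and `(√f - √g)² ≤ |f - g|` gives `d_H² ≤ 2 d_TV`. Pointwise comparison of integrands
  gives `d_H² ≤ d_I` and `d_H² ≤ d_χ²`, and on a countable space `ν ≤ μ + d_S(μ, ν) ν` gives
  `d_TV ≤ d_S`.
* The Prokhorov distance is Mathlib's Lévy–Prokhorov distance. On a bounded space, integrating
  `μ {f ≥ t} ≤ ν {f ≥ t - ε} + ε` over `t` (layer cake) gives `d_W ≤ (1 + diam Ω) d_P`, while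
  bounded Lipschitz functions detect weak convergence, so `d_W` controls it in return.
* On the line, `d_L ≤ d_P` and `d_L ≤ d_K ≤ d_D ≤ 2 d_K`; Lévy convergence forces convergence of the
  distribution functions at the continuity points of the limit, hence weak convergence. If the limit
  has no atoms, its distribution function is uniformly continuous, so the horizontal error allowed
  by `d_L` becomes a vertical one and `d_L`-convergence upgrades to `d_K`-convergence.
-/

namespace ProbMetric

section General

theorem le_of_forall_lt_ofReal {a b : ℝ≥0∞}
    (h : ∀ r : ℝ, b < ENNReal.ofReal r → a ≤ ENNReal.ofReal r) : a ≤ b := by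
  refine le_of_forall_gt_imp_ge_of_dense fun c hbc => ?_
  rcases eq_or_ne c ∞ with rfl | hc
  · exact le_top
  · rw [← ENNReal.ofReal_toReal hc] at hbc ⊢
    exact h _ hbc

variable {Ω : Type*} [MetricSpace Ω] [MeasurableSpace Ω] [BorelSpace Ω]
  {d d' : ProbabilityMeasure Ω → ProbabilityMeasure Ω → ℝ≥0∞}

theorem MetrizesWeakAt.self_eq_zero {ν : ProbabilityMeasure Ω} (h : MetrizesWeakAt d ν) :
    d ν ν = 0 :=
  tendsto_nhds_unique tendsto_const_nhds ((h fun _ => ν).1 tendsto_const_nhds)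

theorem MetrizesWeakAt.eq_of_eq_zero {μ ν : ProbabilityMeasure Ω} (h : MetrizesWeakAt d ν)
    (hμν : d μ ν = 0) : μ = ν :=
  tendsto_nhds_unique tendsto_const_nhds ((h fun _ => μ).2 (by simp only [hμν, tendsto_const_nhds]))

theorem MetrizesWeak.of_metrizesWeakAt [TopologicalSpace.SeparableSpace Ω]
    (hfin : ∀ μ ν, d μ ν ≠ ∞) (hcomm : ∀ μ ν, d μ ν = d ν μ)
    (htri : ∀ μ ν κ, d μ κ ≤ d μ ν + d ν κ) (h : ∀ ν, MetrizesWeakAt d ν) :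
    MetrizesWeak d := by
  let m : MetricSpace (ProbabilityMeasure Ω) :=
    { dist := fun μ ν => (d μ ν).toReal
      dist_self := fun μ => by simp [(h μ).self_eq_zero]
      dist_comm := fun μ ν => by rw [hcomm]
      dist_triangle := fun μ ν κ => by
        rw [← ENNReal.toReal_add (hfin _ _) (hfin _ _)]
        exact ENNReal.toReal_mono (ENNReal.add_ne_top.2 ⟨hfin _ _, hfin _ _⟩) (htri μ ν κ)
      eq_of_dist_eq_zero := fun {μ ν} h0 => (h ν).eq_of_eq_zero
        (((ENNReal.toReal_eq_zero_iff _).1 h0).resolve_right (hfin _ _)) }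
  have tendsto_iff (u : ℕ → ProbabilityMeasure Ω) (ν : ProbabilityMeasure Ω) :
      Tendsto u atTop (@nhds _ m.toUniformSpace.toTopologicalSpace ν) ↔ Tendsto u atTop (𝓝 ν) := by
    rw [h ν u, @tendsto_iff_dist_tendsto_zero _ _ m.toPseudoMetricSpace]
    exact ENNReal.tendsto_toReal_zero_iff fun n => hfin _ _
  refine ⟨m, fun μ ν => (ENNReal.ofReal_toReal (hfin _ _)).symm, le_antisymm ?_ ?_⟩
  -- Both topologies are sequential: one is a metric topology, the other is metrizable because `Ω`
  -- is separable.
  · exact continuous_id_iff_le.1 <| @SeqContinuous.continuous _ _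
      m.toUniformSpace.toTopologicalSpace _ inferInstance _ fun u ν => (tendsto_iff u ν).1
  · exact continuous_id_iff_le.1 <| @SeqContinuous.continuous _ _ _
      m.toUniformSpace.toTopologicalSpace _ _ fun u ν => (tendsto_iff u ν).2

theorem tendsto_zero_of_le_comp {α : Type*} {l : Filter α} {u v : α → ℝ≥0∞} {φ : ℝ≥0∞ → ℝ≥0∞}
    (hφ : Tendsto φ (𝓝 0) (𝓝 0)) (huv : ∀ a, u a ≤ φ (v a)) (hv : Tendsto v l (𝓝 0)) :
    Tendsto u l (𝓝 0) :=
  tendsto_of_tendsto_of_tendsto_of_le_of_le tendsto_const_nhds (hφ.comp hv) (fun _ => zero_le) huv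

theorem ImpliesWeak.of_le_comp {φ : ℝ≥0∞ → ℝ≥0∞} (hd : ImpliesWeak d)
    (hφ : Tendsto φ (𝓝 0) (𝓝 0)) (h : ∀ μ ν, d μ ν ≤ φ (d' μ ν)) : ImpliesWeak d' :=
  fun μ ν hμ => hd μ ν (tendsto_zero_of_le_comp hφ (fun n => h (μ n) ν) hμ)

theorem ImpliesWeak.mono (hd : ImpliesWeak d) (h : ∀ μ ν, d μ ν ≤ d' μ ν) : ImpliesWeak d' :=
  hd.of_le_comp tendsto_id h

theorem MetrizesWeakAt.of_le_comp {ν : ProbabilityMeasure Ω} {φ : ℝ≥0∞ → ℝ≥0∞}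
    (hd : MetrizesWeakAt d ν) (hd' : ImpliesWeak d') (hφ : Tendsto φ (𝓝 0) (𝓝 0))
    (h : ∀ μ, d' μ ν ≤ φ (d μ ν)) : MetrizesWeakAt d' ν :=
  fun μ => ⟨fun hμ => tendsto_zero_of_le_comp hφ (fun n => h (μ n)) ((hd μ).1 hμ), hd' μ ν⟩

theorem tendsto_const_mul_nhds_zero {c : ℝ≥0∞} (hc : c ≠ ∞) :
    Tendsto (fun t => c * t) (𝓝 0) (𝓝 0) := by
  simpa only [mul_zero, id_eq] using ENNReal.Tendsto.const_mul (tendsto_id (x := 𝓝 0)) (Or.inr hc)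

theorem tendsto_rpow_nhds_zero {p : ℝ} (hp : 0 < p) :
    Tendsto (fun t : ℝ≥0∞ => t ^ p) (𝓝 0) (𝓝 0) := by
  simpa only [ENNReal.zero_rpow_of_pos hp] using (ENNReal.continuous_rpow_const (y := p)).tendsto 0

end General

section TotalVariation

variable {Ω : Type*} [MeasurableSpace Ω]

theorem ofReal_abs_measureReal_sub_le_totalVariation (μ ν : ProbabilityMeasure Ω) {A : Set Ω}
    (hA : MeasurableSet A) :
    ENNReal.ofReal |(μ : Measure Ω).real A - (ν : Measure Ω).real A| ≤ totalVariation μ ν :=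
  le_iSup₂ (f := fun (A : Set Ω) (_ : MeasurableSet A) =>
    ENNReal.ofReal |(μ : Measure Ω).real A - (ν : Measure Ω).real A|) A hA

theorem totalVariation_le_one (μ ν : ProbabilityMeasure Ω) : totalVariation μ ν ≤ 1 :=
  iSup₂_le fun _ _ => ENNReal.ofReal_le_one.2 <|
    abs_sub_le_of_nonneg_of_le measureReal_nonneg measureReal_le_one measureReal_nonneg
      measureReal_le_one

theorem totalVariation_ne_top (μ ν : ProbabilityMeasure Ω) : totalVariation μ ν ≠ ∞ :=
  ne_top_of_le_ne_top ENNReal.one_ne_top (totalVariation_le_one μ ν)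

theorem totalVariation_comm (μ ν : ProbabilityMeasure Ω) :
    totalVariation μ ν = totalVariation ν μ := by
  simp only [totalVariation, abs_sub_comm]

theorem totalVariation_triangle (μ ν κ : ProbabilityMeasure Ω) :
    totalVariation μ κ ≤ totalVariation μ ν + totalVariation ν κ := by
  refine iSup₂_le fun A hA => ?_
  calc ENNReal.ofReal |(μ : Measure Ω).real A - (κ : Measure Ω).real A|
      ≤ ENNReal.ofReal |(μ : Measure Ω).real A - (ν : Measure Ω).real A| +
          ENNReal.ofReal |(ν : Measure Ω).real A - (κ : Measure Ω).real A| := by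
        rw [← ENNReal.ofReal_add (abs_nonneg _) (abs_nonneg _)]
        exact ENNReal.ofReal_le_ofReal (abs_sub_le _ _ _)
    _ ≤ totalVariation μ ν + totalVariation ν κ :=
        add_le_add (ofReal_abs_measureReal_sub_le_totalVariation μ ν hA)
          (ofReal_abs_measureReal_sub_le_totalVariation ν κ hA)

theorem measureReal_compl_sub_compl (μ ν : ProbabilityMeasure Ω) {A : Set Ω}
    (hA : MeasurableSet A) :
    (μ : Measure Ω).real Aᶜ - (ν : Measure Ω).real Aᶜ =
      (ν : Measure Ω).real A - (μ : Measure Ω).real A := by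
  rw [probReal_compl_eq_one_sub hA, probReal_compl_eq_one_sub hA, sub_sub_sub_cancel_left]

theorem totalVariation_le_of_forall_le_add {μ ν : ProbabilityMeasure Ω} {s : ℝ≥0∞}
    (h : ∀ A, MeasurableSet A → (μ : Measure Ω) A ≤ (ν : Measure Ω) A + s) :
    totalVariation μ ν ≤ s := by
  have ofReal_sub_le (A : Set Ω) (hA : MeasurableSet A) :
      ENNReal.ofReal ((μ : Measure Ω).real A - (ν : Measure Ω).real A) ≤ s := by
    rw [ENNReal.ofReal_sub _ measureReal_nonneg, ofReal_measureReal, ofReal_measureReal]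
    exact tsub_le_iff_left.2 (h A hA)
  refine iSup₂_le fun A hA => ?_
  rcases abs_choice ((μ : Measure Ω).real A - (ν : Measure Ω).real A) with hpos | hneg
  · rw [hpos]
    exact ofReal_sub_le A hA
  · rw [hneg, neg_sub, ← measureReal_compl_sub_compl μ ν hA]
    exact ofReal_sub_le Aᶜ hA.compl

theorem le_of_forall_singleton_le [Countable Ω] [MeasurableSingletonClass Ω] {ρ σ : Measure Ω}
    (h : ∀ i, ρ {i} ≤ σ {i}) : ρ ≤ σ := by
  refine Measure.le_iff.2 fun A hA => ?_
  rw [← Measure.tsum_indicator_apply_singleton _ _ hA,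
    ← Measure.tsum_indicator_apply_singleton _ _ hA]
  exact ENNReal.tsum_le_tsum fun i => Set.indicator_le_indicator (h i)

theorem le_add_separation_smul [Countable Ω] [MeasurableSingletonClass Ω]
    (μ ν : ProbabilityMeasure Ω) :
    (ν : Measure Ω) ≤ μ + separation μ ν • (ν : Measure Ω) := by
  refine le_of_forall_singleton_le fun i => ?_
  rw [Measure.add_apply, Measure.smul_apply, smul_eq_mul]
  rcases eq_or_ne ((ν : Measure Ω) {i}) 0 with h0 | h0
  · simp [h0]
  have hsep : 1 ≤ (μ : Measure Ω) {i} / (ν : Measure Ω) {i} + separation μ ν :=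
    tsub_le_iff_left.1 <| le_iSup₂ (f := fun (i : Ω) (_ : (ν : Measure Ω) {i} ≠ 0) =>
      (1 - (μ : Measure Ω) {i} / (ν : Measure Ω) {i})) i h0
  calc (ν : Measure Ω) {i} = 1 * (ν : Measure Ω) {i} := (one_mul _).symm
    _ ≤ ((μ : Measure Ω) {i} / (ν : Measure Ω) {i} + separation μ ν) * (ν : Measure Ω) {i} := by
      gcongr
    _ = (μ : Measure Ω) {i} + separation μ ν * (ν : Measure Ω) {i} := by
      rw [add_mul, ENNReal.div_mul_cancel h0 (measure_ne_top _ _)]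

theorem totalVariation_le_separation [Countable Ω] [MeasurableSingletonClass Ω]
    (μ ν : ProbabilityMeasure Ω) : totalVariation μ ν ≤ separation μ ν := by
  rw [totalVariation_comm]
  refine totalVariation_le_of_forall_le_add fun A _ => ?_
  calc (ν : Measure Ω) A ≤ (μ : Measure Ω) A + separation μ ν * (ν : Measure Ω) A :=
      le_add_separation_smul μ ν A
    _ ≤ (μ : Measure Ω) A + separation μ ν := by
      gcongr
      exact mul_le_of_le_one_right' prob_le_one

end TotalVariation

section Hellinger

variable {Ω : Type*} [MeasurableSpace Ω]

instance (μ ν : ProbabilityMeasure Ω) : IsFiniteMeasure (dominating μ ν) :=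
  inferInstanceAs (IsFiniteMeasure ((μ : Measure Ω) + (ν : Measure Ω)))

theorem absolutelyContinuous_dominating_left (μ ν : ProbabilityMeasure Ω) :
    (μ : Measure Ω) ≪ dominating μ ν :=
  (Measure.le_add_right le_rfl).absolutelyContinuous

theorem absolutelyContinuous_dominating_right (μ ν : ProbabilityMeasure Ω) :
    (ν : Measure Ω) ≪ dominating μ ν :=
  (Measure.le_add_left le_rfl).absolutelyContinuous

/-- The real-valued density of `μ` with respect to `ρ`. -/
noncomputable def density (μ ρ : Measure Ω) (x : Ω) : ℝ := (μ.rnDeriv ρ x).toReal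

/-- The square root of the density of `μ` with respect to `ρ`.  The Hellinger distance is the `L²`
distance between square roots of densities. -/
noncomputable def sqrtDensity (μ ρ : Measure Ω) (x : Ω) : ℝ := √(density μ ρ x)

@[fun_prop]
theorem measurable_density (μ ρ : Measure Ω) : Measurable (density μ ρ) :=
  (Measure.measurable_rnDeriv μ ρ).ennreal_toReal

@[fun_prop]
theorem measurable_sqrtDensity (μ ρ : Measure Ω) : Measurable (sqrtDensity μ ρ) :=
  (measurable_density μ ρ).sqrt

theorem density_nonneg (μ ρ : Measure Ω) (x : Ω) : 0 ≤ density μ ρ x := ENNReal.toReal_nonneg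

theorem sqrtDensity_sq (μ ρ : Measure Ω) (x : Ω) : sqrtDensity μ ρ x ^ 2 = density μ ρ x :=
  Real.sq_sqrt (density_nonneg μ ρ x)

theorem integrable_density_sub (μ ν : ProbabilityMeasure Ω) (ρ : Measure Ω) :
    Integrable (density μ ρ - density ν ρ) ρ :=
  Measure.integrable_toReal_rnDeriv.sub Measure.integrable_toReal_rnDeriv

theorem setIntegral_density_sub {μ ν : ProbabilityMeasure Ω} {ρ : Measure Ω} [SigmaFinite ρ]
    (hμ : (μ : Measure Ω) ≪ ρ) (hν : (ν : Measure Ω) ≪ ρ) (A : Set Ω) :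
    ∫ x in A, (density μ ρ - density ν ρ) x ∂ρ =
      (μ : Measure Ω).real A - (ν : Measure Ω).real A := by
  rw [← Measure.setIntegral_toReal_rnDeriv hμ, ← Measure.setIntegral_toReal_rnDeriv hν]
  exact integral_sub Measure.integrable_toReal_rnDeriv.integrableOn
    Measure.integrable_toReal_rnDeriv.integrableOn

theorem two_mul_totalVariation_le_eLpNorm {μ ν : ProbabilityMeasure Ω} {ρ : Measure Ω}
    [SigmaFinite ρ] (hμ : (μ : Measure Ω) ≪ ρ) (hν : (ν : Measure Ω) ≪ ρ) :
    2 * totalVariation μ ν ≤ eLpNorm (density μ ρ - density ν ρ) 1 ρ := by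
  have ofReal_abs_le (A : Set Ω) :
      ENNReal.ofReal |(μ : Measure Ω).real A - (ν : Measure Ω).real A| ≤
        ∫⁻ x in A, ‖(density μ ρ - density ν ρ) x‖ₑ ∂ρ := by
    rw [← setIntegral_density_sub hμ hν, ← Real.enorm_eq_ofReal_abs]
    exact enorm_integral_le_lintegral_enorm _
  simp only [totalVariation, ENNReal.mul_iSup]
  refine iSup₂_le fun A hA => ?_
  rw [eLpNorm_one_eq_lintegral_enorm, ← lintegral_add_compl _ hA, two_mul]
  refine add_le_add (ofReal_abs_le A) ?_
  rw [abs_sub_comm, ← measureReal_compl_sub_compl μ ν hA]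
  exact ofReal_abs_le Aᶜ

theorem eLpNorm_density_sub_le_two_mul_totalVariation {μ ν : ProbabilityMeasure Ω} {ρ : Measure Ω}
    [SigmaFinite ρ] (hμ : (μ : Measure Ω) ≪ ρ) (hν : (ν : Measure Ω) ≪ ρ) :
    eLpNorm (density μ ρ - density ν ρ) 1 ρ ≤ 2 * totalVariation μ ν := by
  set h := density μ ρ - density ν ρ
  have ofReal_le {A : Set Ω} (hA : MeasurableSet A) {r : ℝ}
      (hr : r ≤ |(μ : Measure Ω).real A - (ν : Measure Ω).real A|) :
      ENNReal.ofReal r ≤ totalVariation μ ν :=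
    (ENNReal.ofReal_le_ofReal hr).trans (ofReal_abs_measureReal_sub_le_totalVariation μ ν hA)
  have hmeas : Measurable h := (measurable_density μ ρ).sub (measurable_density ν ρ)
  rw [eLpNorm_one_eq_lintegral_enorm,
    ← ofReal_integral_norm_eq_lintegral_enorm (integrable_density_sub μ ν ρ),
    integral_norm_eq_pos_sub_neg (integrable_density_sub μ ν ρ), setIntegral_density_sub hμ hν,
    setIntegral_density_sub hμ hν, sub_eq_add_neg, two_mul]
  exact ENNReal.ofReal_add_le.trans <| add_le_add
    (ofReal_le (measurableSet_le measurable_const hmeas) (le_abs_self _))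
    (ofReal_le (measurableSet_le hmeas measurable_const) (neg_le_abs _))

theorem eLpNorm_two_sq (F : Ω → ℝ) (ρ : Measure Ω) :
    eLpNorm F 2 ρ ^ 2 = ∫⁻ x, ENNReal.ofReal (F x ^ 2) ∂ρ := by
  have h := eLpNorm_nnreal_pow_eq_lintegral (f := F) (μ := ρ) (p := 2) two_ne_zero
  simpa only [NNReal.coe_ofNat, ENNReal.coe_ofNat, ENNReal.rpow_ofNat, Real.enorm_eq_ofReal_abs,
    ← ENNReal.ofReal_pow (abs_nonneg _), sq_abs] using h

theorem eLpNorm_two_eq_eLpNorm_mul_sqrtDensity {σ ρ : Measure Ω} [SigmaFinite σ] [SigmaFinite ρ]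
    (hσ : σ ≪ ρ) {F : Ω → ℝ} (hF : Measurable F) :
    eLpNorm F 2 σ = eLpNorm (F * sqrtDensity σ ρ) 2 ρ := by
  refine (ENNReal.pow_right_strictMono two_ne_zero).injective ?_
  simp only [eLpNorm_two_sq]
  rw [← lintegral_rnDeriv_mul hσ (by fun_prop)]
  refine lintegral_congr_ae ?_
  filter_upwards [σ.rnDeriv_ne_top ρ] with x hx
  rw [Pi.mul_apply, mul_pow, sqrtDensity_sq, ENNReal.ofReal_mul (sq_nonneg _), density,
    ENNReal.ofReal_toReal hx, mul_comm]

theorem eLpNorm_sqrtDensity (μ : ProbabilityMeasure Ω) {ρ : Measure Ω} [SigmaFinite ρ]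
    (hμ : (μ : Measure Ω) ≪ ρ) : eLpNorm (sqrtDensity μ ρ) 2 ρ = 1 := by
  have h := eLpNorm_two_eq_eLpNorm_mul_sqrtDensity hμ (measurable_const (a := (1 : ℝ)))
  rw [eLpNorm_const _ two_ne_zero (NeZero.ne _)] at h
  simpa [← Pi.one_def] using h.symm

theorem sqrtDensity_mul_sqrtDensity {μ σ ρ : Measure Ω} [SigmaFinite μ] [SigmaFinite σ]
    [SigmaFinite ρ] (hμ : μ ≪ σ) :
    sqrtDensity μ σ * sqrtDensity σ ρ =ᵐ[ρ] sqrtDensity μ ρ := by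
  filter_upwards [Measure.rnDeriv_mul_rnDeriv (κ := ρ) hμ] with x hx
  rw [Pi.mul_apply, sqrtDensity, sqrtDensity, sqrtDensity, density, density, density, ← hx,
    Pi.mul_apply, ENNReal.toReal_mul, Real.sqrt_mul ENNReal.toReal_nonneg]

theorem hellinger_eq_eLpNorm {μ ν : ProbabilityMeasure Ω} {ρ : Measure Ω} [SigmaFinite ρ]
    (hμ : (μ : Measure Ω) ≪ ρ) (hν : (ν : Measure Ω) ≪ ρ) :
    hellinger μ ν = eLpNorm (sqrtDensity μ ρ - sqrtDensity ν ρ) 2 ρ := by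
  set σ := dominating μ ν
  have hσρ : σ ≪ ρ := hμ.add_left hν
  calc hellinger μ ν
      = (eLpNorm (sqrtDensity μ σ - sqrtDensity ν σ) 2 σ ^ 2) ^ (1 / 2 : ℝ) := by
        rw [eLpNorm_two_sq]; rfl
    _ = eLpNorm (sqrtDensity μ σ - sqrtDensity ν σ) 2 σ := by
        rw [← ENNReal.rpow_natCast, ← ENNReal.rpow_mul]; norm_num
    _ = eLpNorm ((sqrtDensity μ σ - sqrtDensity ν σ) * sqrtDensity σ ρ) 2 ρ :=
        eLpNorm_two_eq_eLpNorm_mul_sqrtDensity hσρ (by fun_prop)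
    _ = eLpNorm (sqrtDensity μ ρ - sqrtDensity ν ρ) 2 ρ := by
        rw [sub_mul]
        exact eLpNorm_congr_ae <|
          (sqrtDensity_mul_sqrtDensity (absolutelyContinuous_dominating_left μ ν)).sub
            (sqrtDensity_mul_sqrtDensity (absolutelyContinuous_dominating_right μ ν))

theorem hellinger_comm (μ ν : ProbabilityMeasure Ω) : hellinger μ ν = hellinger ν μ := by
  have hμ := absolutelyContinuous_dominating_left μ ν
  have hν := absolutelyContinuous_dominating_right μ ν
  rw [hellinger_eq_eLpNorm hμ hν, hellinger_eq_eLpNorm hν hμ, eLpNorm_sub_comm]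

theorem hellinger_triangle (μ ν κ : ProbabilityMeasure Ω) :
    hellinger μ κ ≤ hellinger μ ν + hellinger ν κ := by
  set ρ : Measure Ω := μ + ν + κ
  have hμ : (μ : Measure Ω) ≪ ρ :=
    (Measure.le_add_right (Measure.le_add_right le_rfl)).absolutelyContinuous
  have hν : (ν : Measure Ω) ≪ ρ :=
    (Measure.le_add_right (Measure.le_add_left le_rfl)).absolutelyContinuous
  have hκ : (κ : Measure Ω) ≪ ρ := (Measure.le_add_left le_rfl).absolutelyContinuous
  rw [hellinger_eq_eLpNorm hμ hκ, hellinger_eq_eLpNorm hμ hν, hellinger_eq_eLpNorm hν hκ,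
    ← sub_add_sub_cancel (sqrtDensity μ ρ) (sqrtDensity ν ρ) (sqrtDensity κ ρ)]
  exact eLpNorm_add_le (by fun_prop) (by fun_prop) one_le_two

theorem totalVariation_le_hellinger (μ ν : ProbabilityMeasure Ω) :
    totalVariation μ ν ≤ hellinger μ ν := by
  set ρ := dominating μ ν
  have hμ : (μ : Measure Ω) ≪ ρ := absolutelyContinuous_dominating_left μ ν
  have hν : (ν : Measure Ω) ≪ ρ := absolutelyContinuous_dominating_right μ ν
  have density_sub : density μ ρ - density ν ρ =
      (sqrtDensity μ ρ - sqrtDensity ν ρ) • (sqrtDensity μ ρ + sqrtDensity ν ρ) := by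
    ext x
    simp only [Pi.sub_apply, smul_eq_mul, Pi.mul_apply, Pi.add_apply, ← sqrtDensity_sq]
    ring
  have eLpNorm_add_le_two : eLpNorm (sqrtDensity μ ρ + sqrtDensity ν ρ) 2 ρ ≤ 2 :=
    calc eLpNorm (sqrtDensity μ ρ + sqrtDensity ν ρ) 2 ρ
        ≤ eLpNorm (sqrtDensity μ ρ) 2 ρ + eLpNorm (sqrtDensity ν ρ) 2 ρ :=
          eLpNorm_add_le (by fun_prop) (by fun_prop) one_le_two
      _ = 2 := by rw [eLpNorm_sqrtDensity μ hμ, eLpNorm_sqrtDensity ν hν, one_add_one_eq_two]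
  refine (ENNReal.mul_le_mul_iff_right two_ne_zero ENNReal.ofNat_ne_top).1 ?_
  calc 2 * totalVariation μ ν ≤ eLpNorm (density μ ρ - density ν ρ) 1 ρ :=
        two_mul_totalVariation_le_eLpNorm hμ hν
    _ ≤ eLpNorm (sqrtDensity μ ρ - sqrtDensity ν ρ) 2 ρ *
          eLpNorm (sqrtDensity μ ρ + sqrtDensity ν ρ) 2 ρ := by
        rw [density_sub]
        exact eLpNorm_smul_le_mul_eLpNorm (by fun_prop) (by fun_prop)
    _ ≤ hellinger μ ν * 2 := by
        rw [hellinger_eq_eLpNorm hμ hν]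
        gcongr
    _ = 2 * hellinger μ ν := mul_comm _ _

theorem hellinger_sq_eq_lintegral {μ ν : ProbabilityMeasure Ω} {ρ : Measure Ω} [SigmaFinite ρ]
    (hμ : (μ : Measure Ω) ≪ ρ) (hν : (ν : Measure Ω) ≪ ρ) :
    hellinger μ ν ^ 2 =
      ∫⁻ x, ENNReal.ofReal ((√(density μ ρ x) - √(density ν ρ x)) ^ 2) ∂ρ := by
  rw [hellinger_eq_eLpNorm hμ hν, eLpNorm_two_sq]
  rfl

theorem le_rpow_half_of_sq_le {a b : ℝ≥0∞} (h : a ^ 2 ≤ b) : a ≤ b ^ (2⁻¹ : ℝ) :=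
  (ENNReal.le_rpow_inv_iff two_pos).2 (by rwa [ENNReal.rpow_ofNat])

theorem sq_sqrt_sub_sqrt_le_abs_sub {a b : ℝ} (ha : 0 ≤ a) (hb : 0 ≤ b) :
    (√a - √b) ^ 2 ≤ |a - b| := by
  have h : |a - b| = |√a - √b| * (√a + √b) := by
    rw [← abs_of_nonneg (add_nonneg (Real.sqrt_nonneg a) (Real.sqrt_nonneg b)), ← abs_mul,
      mul_comm, ← sq_sub_sq, Real.sq_sqrt ha, Real.sq_sqrt hb]
  rw [h, ← sq_abs, sq]
  gcongr
  exact abs_sub_le_iff.2 ⟨by linarith [Real.sqrt_nonneg b], by linarith [Real.sqrt_nonneg a]⟩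

theorem hellinger_sq_le_two_mul_totalVariation (μ ν : ProbabilityMeasure Ω) :
    hellinger μ ν ^ 2 ≤ 2 * totalVariation μ ν := by
  have hμ := absolutelyContinuous_dominating_left μ ν
  have hν := absolutelyContinuous_dominating_right μ ν
  refine le_trans ?_ (eLpNorm_density_sub_le_two_mul_totalVariation hμ hν)
  rw [hellinger_sq_eq_lintegral hμ hν, eLpNorm_one_eq_lintegral_enorm]
  refine lintegral_mono fun x => ?_
  rw [Real.enorm_eq_ofReal_abs]
  exact ENNReal.ofReal_le_ofReal
    (sq_sqrt_sub_sqrt_le_abs_sub (density_nonneg _ _ _) (density_nonneg _ _ _))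

theorem hellinger_ne_top (μ ν : ProbabilityMeasure Ω) : hellinger μ ν ≠ ∞ := by
  have hsq : hellinger μ ν ^ 2 ≠ ∞ :=
    ne_top_of_le_ne_top (ENNReal.mul_ne_top ENNReal.ofNat_ne_top (totalVariation_ne_top μ ν))
      (hellinger_sq_le_two_mul_totalVariation μ ν)
  simpa using hsq

theorem sqrt_sub_one_sq_le_klFun {x : ℝ} (hx : 0 ≤ x) :
    (√x - 1) ^ 2 ≤ InformationTheory.klFun x := by
  rcases hx.eq_or_lt with rfl | hx
  · simp [InformationTheory.klFun]
  have hlog : 1 - (√x)⁻¹ ≤ Real.log √x := Real.one_sub_inv_le_log_of_pos (Real.sqrt_pos.2 hx)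
  have hmul : x * (1 - (√x)⁻¹) = x - √x := by
    rw [mul_sub, mul_one, ← div_eq_mul_inv, Real.div_sqrt]
  have hsqrt : x - √x ≤ x * (Real.log x / 2) := by
    rw [← hmul, ← Real.log_sqrt hx.le]
    gcongr
  rw [InformationTheory.klFun, sub_sq, Real.sq_sqrt hx.le]
  linarith

theorem hellinger_sq_le_relativeEntropy (μ ν : ProbabilityMeasure Ω) :
    hellinger μ ν ^ 2 ≤ relativeEntropy μ ν := by
  rw [relativeEntropy]
  by_cases hμν : (μ : Measure Ω) ≪ ν
  · rw [InformationTheory.klDiv_eq_lintegral_klFun_of_ac hμν,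
      hellinger_sq_eq_lintegral hμν Measure.AbsolutelyContinuous.rfl]
    refine lintegral_mono_ae ?_
    filter_upwards [Measure.rnDeriv_self (ν : Measure Ω)] with x hx
    simp only [density, hx, ENNReal.toReal_one, Real.sqrt_one]
    exact ENNReal.ofReal_le_ofReal (sqrt_sub_one_sq_le_klFun ENNReal.toReal_nonneg)
  · rw [InformationTheory.klDiv_of_not_ac hμν]
    exact le_top

theorem sq_sqrt_sub_sqrt_mul_le {a b : ℝ} (ha : 0 ≤ a) (hb : 0 ≤ b) :
    (√a - √b) ^ 2 * b ≤ (a - b) ^ 2 :=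
  calc (√a - √b) ^ 2 * b ≤ (√a - √b) ^ 2 * (√a + √b) ^ 2 := by
        gcongr
        exact (Real.sqrt_le_left (by positivity)).1 (le_add_of_nonneg_left (Real.sqrt_nonneg a))
    _ = (a - b) ^ 2 := by
        rw [← mul_pow, mul_comm, ← sq_sub_sq, Real.sq_sqrt ha, Real.sq_sqrt hb]

theorem ofReal_sq_sqrt_sub_sqrt_le_div {a b : ℝ} (ha : 0 ≤ a) (hb : 0 ≤ b) :
    ENNReal.ofReal ((√a - √b) ^ 2) ≤ ENNReal.ofReal ((a - b) ^ 2) / ENNReal.ofReal b := by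
  rcases hb.eq_or_lt with rfl | hb'
  · rcases ha.eq_or_lt with rfl | ha'
    · simp
    · rw [ENNReal.ofReal_zero, ENNReal.div_zero (by simpa using ha'.ne')]
      exact le_top
  · rw [← ENNReal.ofReal_div_of_pos hb']
    exact ENNReal.ofReal_le_ofReal ((le_div_iff₀ hb').2 (sq_sqrt_sub_sqrt_mul_le ha hb))

theorem hellinger_sq_le_chiSquare (μ ν : ProbabilityMeasure Ω) :
    hellinger μ ν ^ 2 ≤ chiSquare μ ν := by
  set ρ := dominating μ ν with hρ
  rw [hellinger_sq_eq_lintegral (absolutelyContinuous_dominating_left μ ν)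
    (absolutelyContinuous_dominating_right μ ν), chiSquare, ← hρ]
  refine lintegral_mono_ae ?_
  filter_upwards [(ν : Measure Ω).rnDeriv_ne_top ρ] with x hν
  have h := ofReal_sq_sqrt_sub_sqrt_le_div (density_nonneg μ ρ x) (density_nonneg ν ρ x)
  rwa [density, density, ENNReal.ofReal_toReal hν] at h

end Hellinger

section TotalVariationWeak

variable {Ω : Type*} [MetricSpace Ω] [MeasurableSpace Ω] [BorelSpace Ω]

theorem impliesWeak_totalVariation : ImpliesWeak (Ω := Ω) totalVariation := by
  intro μ ν hTV
  have tendsto_measure {A : Set Ω} (hA : MeasurableSet A) :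
      Tendsto (fun n => (μ n : Measure Ω) A) atTop (𝓝 ((ν : Measure Ω) A)) := by
    rw [← ENNReal.tendsto_toReal_iff (fun _ => measure_ne_top _ _) (measure_ne_top _ _),
      tendsto_iff_edist_tendsto_0]
    refine tendsto_zero_of_le_comp tendsto_id (fun n => ?_) hTV
    rw [edist_dist, Real.dist_eq]
    exact ofReal_abs_measureReal_sub_le_totalVariation (μ n) ν hA
  exact tendsto_of_forall_isOpen_le_liminf' fun G hG =>
    (tendsto_measure hG.measurableSet).liminf_eq.ge

theorem impliesWeak_hellinger : ImpliesWeak (Ω := Ω) hellinger :=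
  impliesWeak_totalVariation.mono totalVariation_le_hellinger

theorem ImpliesWeak.of_hellinger_sq_le
    {d : ProbabilityMeasure Ω → ProbabilityMeasure Ω → ℝ≥0∞}
    (h : ∀ μ ν, hellinger μ ν ^ 2 ≤ d μ ν) : ImpliesWeak d :=
  impliesWeak_hellinger.of_le_comp (tendsto_rpow_nhds_zero (inv_pos.2 two_pos))
    fun μ ν => le_rpow_half_of_sq_le (h μ ν)

theorem impliesWeak_relativeEntropy : ImpliesWeak (Ω := Ω) relativeEntropy :=
  .of_hellinger_sq_le hellinger_sq_le_relativeEntropy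

theorem impliesWeak_relativeEntropy_swap : ImpliesWeak (Ω := Ω) fun μ ν => relativeEntropy ν μ :=
  .of_hellinger_sq_le fun μ ν => hellinger_comm μ ν ▸ hellinger_sq_le_relativeEntropy ν μ

theorem impliesWeak_chiSquare : ImpliesWeak (Ω := Ω) chiSquare :=
  .of_hellinger_sq_le hellinger_sq_le_chiSquare

theorem impliesWeak_chiSquare_swap : ImpliesWeak (Ω := Ω) fun μ ν => chiSquare ν μ :=
  .of_hellinger_sq_le fun μ ν => hellinger_comm μ ν ▸ hellinger_sq_le_chiSquare ν μ

theorem impliesWeak_separation [Countable Ω] : ImpliesWeak (Ω := Ω) separation :=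
  impliesWeak_totalVariation.mono totalVariation_le_separation

theorem impliesWeak_separation_swap [Countable Ω] :
    ImpliesWeak (Ω := Ω) fun μ ν => separation ν μ :=
  impliesWeak_totalVariation.mono fun μ ν =>
    totalVariation_comm μ ν ▸ totalVariation_le_separation ν μ

end TotalVariationWeak

section Prokhorov

variable {Ω : Type*} [MetricSpace Ω] [MeasurableSpace Ω] [BorelSpace Ω]

theorem prokhorov_eq_levyProkhorovEDist (μ ν : ProbabilityMeasure Ω) :
    prokhorov μ ν = levyProkhorovEDist (μ : Measure Ω) (ν : Measure Ω) := by
  set S := {ε : ℝ | 0 < ε ∧ ∀ B : Set Ω, MeasurableSet B →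
    (μ : Measure Ω) B ≤ (ν : Measure Ω) (Metric.cthickening ε B) + ENNReal.ofReal ε}
  have mem_of_lt {ε : ℝ}
      (hε : levyProkhorovEDist (μ : Measure Ω) (ν : Measure Ω) < ENNReal.ofReal ε) : ε ∈ S := by
    have hε0 : 0 < ε := ENNReal.ofReal_pos.1 (bot_le.trans_lt hε)
    refine ⟨hε0, fun B hB => (left_measure_le_of_levyProkhorovEDist_lt hε hB).trans ?_⟩
    rw [ENNReal.toReal_ofReal hε0.le]
    grw [Metric.thickening_subset_cthickening]
  refine le_antisymm (le_of_forall_lt_ofReal fun ε hε => ?_)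
    (levyProkhorovEDist_le_of_forall_le _ _ _ fun δ B hδ hδtop hB => ?_)
  · exact ENNReal.ofReal_le_ofReal (csInf_le ⟨0, fun _ h => h.1.le⟩ (mem_of_lt hε))
  · have one_mem : (1 : ℝ) ∈ S :=
      ⟨one_pos, fun B _ => prob_le_one.trans (ENNReal.ofReal_one.symm.le.trans le_add_self)⟩
    have hlt : sInf S < δ.toReal :=
      (ENNReal.ofReal_lt_iff_lt_toReal (Real.sInf_nonneg fun _ h => h.1.le) hδtop.ne).1 hδ
    obtain ⟨ε, ⟨hε0, hε⟩, hεδ⟩ := exists_lt_of_csInf_lt ⟨1, one_mem⟩ hlt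
    grw [hε B hB, Metric.cthickening_subset_thickening' (hε0.trans hεδ) hεδ B,
      ENNReal.ofReal_le_of_le_toReal hεδ.le]

theorem prokhorov_comm (μ ν : ProbabilityMeasure Ω) : prokhorov μ ν = prokhorov ν μ := by
  simp only [prokhorov_eq_levyProkhorovEDist, levyProkhorovEDist_comm]

theorem measure_le_of_prokhorov_lt {μ ν : ProbabilityMeasure Ω} {ε : ℝ}
    (h : prokhorov μ ν < ENNReal.ofReal ε) {B : Set Ω} (hB : MeasurableSet B) :
    (μ : Measure Ω) B ≤ (ν : Measure Ω) (Metric.thickening ε B) + ENNReal.ofReal ε := by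
  have hε : 0 < ε := ENNReal.ofReal_pos.1 (bot_le.trans_lt h)
  rw [prokhorov_eq_levyProkhorovEDist] at h
  simpa only [ENNReal.toReal_ofReal hε.le] using left_measure_le_of_levyProkhorovEDist_lt h hB

variable [TopologicalSpace.SeparableSpace Ω]

theorem metrizesWeakAt_prokhorov (ν : ProbabilityMeasure Ω) : MetrizesWeakAt prokhorov ν := by
  intro μ
  simp only [prokhorov_eq_levyProkhorovEDist]
  rw [(LevyProkhorov.probabilityMeasureHomeomorph (Ω := Ω)).isInducing.tendsto_nhds_iff,
    tendsto_iff_edist_tendsto_0]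
  rfl

theorem metrizesWeak_prokhorov : MetrizesWeak (Ω := Ω) prokhorov := by
  refine .of_metrizesWeakAt (fun μ ν => ?_) prokhorov_comm (fun μ ν κ => ?_)
    metrizesWeakAt_prokhorov
  · exact ENNReal.ofReal_ne_top
  · simp only [prokhorov_eq_levyProkhorovEDist]
    exact levyProkhorovEDist_triangle _ _ _

end Prokhorov

section Wasserstein

variable {Ω : Type*} [MetricSpace Ω] [MeasurableSpace Ω]

theorem ofReal_abs_integral_sub_le_wasserstein {μ ν : ProbabilityMeasure Ω} {f : Ω → ℝ}
    (hf : LipschitzWith 1 f) (hμ : Integrable f (μ : Measure Ω))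
    (hν : Integrable f (ν : Measure Ω)) :
    ENNReal.ofReal |∫ x, f x ∂(μ : Measure Ω) - ∫ x, f x ∂(ν : Measure Ω)| ≤ wasserstein μ ν :=
  le_iSup_of_le f <| le_iSup_of_le (fun x y => by simpa [Real.dist_eq] using hf.dist_le_mul x y) <|
    le_iSup₂_of_le hμ hν le_rfl

theorem wasserstein_le {μ ν : ProbabilityMeasure Ω} {s : ℝ≥0∞}
    (h : ∀ f : Ω → ℝ, LipschitzWith 1 f → Integrable f (μ : Measure Ω) →
      Integrable f (ν : Measure Ω) →
        ENNReal.ofReal |∫ x, f x ∂(μ : Measure Ω) - ∫ x, f x ∂(ν : Measure Ω)| ≤ s) :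
    wasserstein μ ν ≤ s :=
  iSup₂_le fun f hf => iSup₂_le fun hμ hν => h f (.mk_one hf) hμ hν

theorem wasserstein_comm (μ ν : ProbabilityMeasure Ω) : wasserstein μ ν = wasserstein ν μ := by
  have wasserstein_le_swap (μ ν : ProbabilityMeasure Ω) : wasserstein μ ν ≤ wasserstein ν μ :=
    wasserstein_le fun f hf hμ hν => by
      rw [abs_sub_comm]
      exact ofReal_abs_integral_sub_le_wasserstein hf hν hμ
  exact le_antisymm (wasserstein_le_swap μ ν) (wasserstein_le_swap ν μ)

theorem ofReal_abs_integral_sub_le_mul_wasserstein {μ ν : ProbabilityMeasure Ω} {f : Ω → ℝ}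
    {L : NNReal} (hL : L ≠ 0) (hf : LipschitzWith L f) (hμ : Integrable f (μ : Measure Ω))
    (hν : Integrable f (ν : Measure Ω)) :
    ENNReal.ofReal |∫ x, f x ∂(μ : Measure Ω) - ∫ x, f x ∂(ν : Measure Ω)| ≤
      L * wasserstein μ ν := by
  have hscaled : LipschitzWith 1 fun x => (L : ℝ)⁻¹ * f x := by
    refine .mk_one fun x y => ?_
    rw [Real.dist_eq, ← mul_sub, abs_mul, abs_of_nonneg (inv_nonneg.2 L.coe_nonneg),
      inv_mul_le_iff₀ (by positivity), ← Real.dist_eq]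
    exact hf.dist_le_mul x y
  have h := ofReal_abs_integral_sub_le_wasserstein hscaled (hμ.const_mul _) (hν.const_mul _)
  rw [integral_const_mul, integral_const_mul, ← mul_sub, abs_mul,
    abs_of_nonneg (inv_nonneg.2 L.coe_nonneg), ← NNReal.coe_inv,
    ENNReal.ofReal_mul (NNReal.coe_nonneg _), ENNReal.ofReal_coe_nnreal, ENNReal.coe_inv hL] at h
  rwa [← ENNReal.inv_mul_le_iff (by simpa) ENNReal.coe_ne_top]

variable [BorelSpace Ω]

theorem impliesWeak_wasserstein : ImpliesWeak (Ω := Ω) wasserstein := by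
  intro μ ν hW
  rw [tendsto_iff_forall_lipschitz_integral_tendsto]
  rintro f ⟨C, hC⟩ ⟨L, hL⟩
  have hint (ρ : ProbabilityMeasure Ω) : Integrable f (ρ : Measure Ω) :=
    BoundedContinuousFunction.integrable (ρ : Measure Ω) ⟨⟨f, hL.continuous⟩, C, hC⟩
  have hL' : LipschitzWith (L + 1) f := hL.weaken le_self_add
  rw [tendsto_iff_edist_tendsto_0]
  refine tendsto_zero_of_le_comp (tendsto_const_mul_nhds_zero (c := (L + 1 : NNReal))
    ENNReal.coe_ne_top) (fun n => ?_) hW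
  rw [edist_dist, Real.dist_eq]
  exact ofReal_abs_integral_sub_le_mul_wasserstein (by positivity) hL' (hint _) (hint _)

theorem lintegral_le_of_prokhorov_lt {μ ν : ProbabilityMeasure Ω} {ε : ℝ}
    (hε : prokhorov μ ν < ENNReal.ofReal ε) {f : Ω → ℝ} (hf : LipschitzWith 1 f)
    (hf0 : ∀ x, 0 ≤ f x) {D : ℝ} (hfD : ∀ x, f x ≤ D) :
    ∫⁻ x, ENNReal.ofReal (f x) ∂(μ : Measure Ω) ≤
      ∫⁻ x, ENNReal.ofReal (f x) ∂(ν : Measure Ω) +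
        ENNReal.ofReal ε * (1 + ENNReal.ofReal D) := by
  have hε0 : 0 < ε := ENNReal.ofReal_pos.1 (bot_le.trans_lt hε)
  have hmeas : Measurable f := hf.continuous.measurable
  have thickening_subset (t : ℝ) : Metric.thickening ε {x | t ≤ f x} ⊆ {x | t ≤ f x + ε} := by
    intro x hx
    obtain ⟨y, hy, hxy⟩ := Metric.mem_thickening_iff.1 hx
    have hlip : f y ≤ f x + dist y x := by simpa using hf.le_add_mul y x
    rw [dist_comm] at hlip
    exact hy.out.trans (by linarith)
  have superlevel_le (t : ℝ) : (μ : Measure Ω) {x | t ≤ f x} ≤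
      (ν : Measure Ω) {x | t ≤ f x + ε} + (Set.Iic D).indicator (fun _ => ENNReal.ofReal ε) t := by
    by_cases ht : t ≤ D
    · rw [Set.indicator_of_mem (show t ∈ Set.Iic D from ht)]
      grw [measure_le_of_prokhorov_lt hε (measurableSet_le measurable_const hmeas),
        thickening_subset]
    · have hempty : {x | t ≤ f x} = ∅ := by
        ext x; simpa using (hfD x).trans_lt (not_le.1 ht)
      simp [hempty]
  calc ∫⁻ x, ENNReal.ofReal (f x) ∂(μ : Measure Ω)
      = ∫⁻ t in Set.Ioi 0, (μ : Measure Ω) {x | t ≤ f x} :=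
        lintegral_eq_lintegral_meas_le _ (.of_forall hf0) hmeas.aemeasurable
    _ ≤ ∫⁻ t in Set.Ioi 0, ((ν : Measure Ω) {x | t ≤ f x + ε} +
          (Set.Iic D).indicator (fun _ => ENNReal.ofReal ε) t) := lintegral_mono superlevel_le
    _ = ∫⁻ x, ENNReal.ofReal (f x + ε) ∂(ν : Measure Ω) +
          ENNReal.ofReal ε * ENNReal.ofReal D := by
        rw [lintegral_add_right _ (measurable_const.indicator measurableSet_Iic),
          ← lintegral_eq_lintegral_meas_le (f := fun x => f x + ε) _
            (.of_forall fun x => add_nonneg (hf0 x) hε0.le) (by fun_prop),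
          lintegral_indicator_const measurableSet_Iic,
          Measure.restrict_apply measurableSet_Iic, Set.inter_comm, Set.Ioi_inter_Iic,
          Real.volume_Ioc, sub_zero]
    _ = ∫⁻ x, ENNReal.ofReal (f x) ∂(ν : Measure Ω) +
          ENNReal.ofReal ε * (1 + ENNReal.ofReal D) := by
        simp only [fun x => ENNReal.ofReal_add (hf0 x) hε0.le]
        rw [lintegral_add_right _ measurable_const, lintegral_const, measure_univ, mul_one,
          mul_add, mul_one, add_assoc]

theorem integral_sub_le_of_prokhorov_lt {μ ν : ProbabilityMeasure Ω} {ε : ℝ}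
    (hε : prokhorov μ ν < ENNReal.ofReal ε) {f : Ω → ℝ} (hf : LipschitzWith 1 f)
    (hμ : Integrable f (μ : Measure Ω)) (hν : Integrable f (ν : Measure Ω)) {c D : ℝ}
    (hcf : ∀ x, c ≤ f x) (hfD : ∀ x, f x ≤ c + D) :
    ENNReal.ofReal (∫ x, f x ∂(μ : Measure Ω) - ∫ x, f x ∂(ν : Measure Ω)) ≤
      ENNReal.ofReal ε * (1 + ENNReal.ofReal D) := by
  have hnonneg (x : Ω) : 0 ≤ f x - c := sub_nonneg.2 (hcf x)
  have hshift : LipschitzWith 1 fun x => f x - c := by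
    simpa [sub_eq_add_neg] using hf.add (LipschitzWith.const (-c))
  have ofReal_integral_shift {ρ : ProbabilityMeasure Ω} (hρ : Integrable f (ρ : Measure Ω)) :
      ENNReal.ofReal (∫ x, f x ∂(ρ : Measure Ω) - c) =
        ∫⁻ x, ENNReal.ofReal (f x - c) ∂(ρ : Measure Ω) := by
    have hint : Integrable (fun x => f x - c) (ρ : Measure Ω) := hρ.sub (integrable_const c)
    rw [← ofReal_integral_eq_lintegral_ofReal hint (.of_forall hnonneg),
      integral_sub hρ (integrable_const c), integral_const, probReal_univ, one_smul]
  have hc : c ≤ ∫ x, f x ∂(ν : Measure Ω) := by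
    simpa using integral_mono (integrable_const c) hν hcf
  rw [← sub_sub_sub_cancel_right _ _ c, ENNReal.ofReal_sub _ (sub_nonneg.2 hc), tsub_le_iff_left,
    ofReal_integral_shift hμ, ofReal_integral_shift hν]
  exact lintegral_le_of_prokhorov_lt hε hshift hnonneg fun x => sub_le_iff_le_add'.2 (hfD x)

variable [BoundedSpace Ω]

theorem integrable_of_lipschitzWith {L : NNReal} {f : Ω → ℝ} (hf : LipschitzWith L f)
    (μ : ProbabilityMeasure Ω) : Integrable f (μ : Measure Ω) :=
  BoundedContinuousFunction.integrable (μ : Measure Ω)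
    ⟨⟨f, hf.continuous⟩, L * Metric.diam (Set.univ : Set Ω), fun x y => by
      grw [hf.dist_le_mul x y, Metric.dist_le_diam_of_mem (Bornology.IsBounded.all _)
        (Set.mem_univ x) (Set.mem_univ y)]⟩

theorem wasserstein_triangle (μ ν κ : ProbabilityMeasure Ω) :
    wasserstein μ κ ≤ wasserstein μ ν + wasserstein ν κ := by
  refine wasserstein_le fun f hf hμ hκ => ?_
  have hν := integrable_of_lipschitzWith hf ν
  grw [← ofReal_abs_integral_sub_le_wasserstein hf hμ hν,
    ← ofReal_abs_integral_sub_le_wasserstein hf hν hκ,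
    ← ENNReal.ofReal_add (abs_nonneg _) (abs_nonneg _), abs_sub_le _ (∫ x, f x ∂(ν : Measure Ω)) _]

theorem wasserstein_le_prokhorov_mul (μ ν : ProbabilityMeasure Ω) :
    wasserstein μ ν ≤
      prokhorov μ ν * (1 + ENNReal.ofReal (Metric.diam (Set.univ : Set Ω))) := by
  rw [← ENNReal.div_le_iff (by simp) (by simp)]
  refine le_of_forall_lt_ofReal fun ε hε => ENNReal.div_le_of_le_mul <|
    wasserstein_le fun f hf hμ hν => ?_
  have hΩ : Nonempty Ω := μ.nonempty
  have hosc (x y : Ω) : f x ≤ f y + Metric.diam (Set.univ : Set Ω) := by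
    grw [hf.le_add_mul x y, NNReal.coe_one, one_mul, Metric.dist_le_diam_of_mem
      (Bornology.IsBounded.all _) (Set.mem_univ x) (Set.mem_univ y)]
  have hbdd : BddBelow (Set.range f) :=
    ⟨f hΩ.some - Metric.diam (Set.univ : Set Ω), by
      rintro _ ⟨y, rfl⟩
      exact sub_le_iff_le_add.2 (hosc _ y)⟩
  have iInf_le (x : Ω) : ⨅ y, f y ≤ f x := ciInf_le hbdd x
  have le_iInf_add (x : Ω) : f x ≤ (⨅ y, f y) + Metric.diam (Set.univ : Set Ω) :=
    sub_le_iff_le_add.1 (le_ciInf fun y => sub_le_iff_le_add.2 (hosc x y))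
  rw [abs, ENNReal.ofReal_max, neg_sub]
  exact max_le (integral_sub_le_of_prokhorov_lt hε hf hμ hν iInf_le le_iInf_add)
    (integral_sub_le_of_prokhorov_lt (prokhorov_comm μ ν ▸ hε) hf hν hμ iInf_le le_iInf_add)

theorem wasserstein_ne_top (μ ν : ProbabilityMeasure Ω) : wasserstein μ ν ≠ ∞ :=
  ne_top_of_le_ne_top (by finiteness [show prokhorov μ ν ≠ ∞ from ENNReal.ofReal_ne_top])
    (wasserstein_le_prokhorov_mul μ ν)

theorem metrizesWeak_wasserstein [TopologicalSpace.SeparableSpace Ω] :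
    MetrizesWeak (Ω := Ω) wasserstein :=
  .of_metrizesWeakAt wasserstein_ne_top wasserstein_comm wasserstein_triangle fun ν =>
    (metrizesWeakAt_prokhorov ν).of_le_comp impliesWeak_wasserstein
      (tendsto_const_mul_nhds_zero (by finiteness)) fun μ =>
        (wasserstein_le_prokhorov_mul μ ν).trans (mul_comm _ _).le

end Wasserstein

section FiniteSpace

variable {Ω : Type*} [MetricSpace Ω] [MeasurableSpace Ω] [BorelSpace Ω] [Finite Ω]

theorem metrizesWeakAt_totalVariation (ν : ProbabilityMeasure Ω) :
    MetrizesWeakAt totalVariation ν := by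
  refine fun μ => ⟨fun hμ => ENNReal.tendsto_nhds_zero.2 fun ε hε => ?_,
    impliesWeak_totalVariation μ ν⟩
  have tendsto_measureReal (A : Set Ω) :
      Tendsto (fun n => (μ n : Measure Ω).real A) atTop (𝓝 ((ν : Measure Ω).real A)) :=
    NNReal.tendsto_coe.2 <|
      ProbabilityMeasure.tendsto_measure_of_isClopen_of_tendsto hμ (isClopen_discrete A)
  have eventually_le (A : Set Ω) : ∀ᶠ n in atTop,
      ENNReal.ofReal |(μ n : Measure Ω).real A - (ν : Measure Ω).real A| ≤ ε := by
    simp only [← Real.dist_eq, ← edist_dist]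
    exact ENNReal.tendsto_nhds_zero.1 (tendsto_iff_edist_tendsto_0.1 (tendsto_measureReal A)) ε hε
  filter_upwards [eventually_all.2 eventually_le] with n hn
  exact iSup₂_le fun A _ => hn A

theorem metrizesWeak_totalVariation : MetrizesWeak (Ω := Ω) totalVariation :=
  .of_metrizesWeakAt totalVariation_ne_top totalVariation_comm totalVariation_triangle
    metrizesWeakAt_totalVariation

theorem metrizesWeak_hellinger : MetrizesWeak (Ω := Ω) hellinger :=
  .of_metrizesWeakAt hellinger_ne_top hellinger_comm hellinger_triangle fun ν =>
    (metrizesWeakAt_totalVariation ν).of_le_comp impliesWeak_hellinger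
      ((tendsto_rpow_nhds_zero (by norm_num)).comp
        (tendsto_const_mul_nhds_zero ENNReal.ofNat_ne_top))
      fun μ => le_rpow_half_of_sq_le (hellinger_sq_le_two_mul_totalVariation μ ν)

end FiniteSpace

section Levy

/-- The set whose infimum is the Lévy distance of `μ` and `ν`. -/
def levySet (μ ν : ProbabilityMeasure ℝ) : Set ℝ :=
  {ε : ℝ | 0 < ε ∧ ∀ x : ℝ,
    cdf (ν : Measure ℝ) (x - ε) - ε ≤ cdf (μ : Measure ℝ) x ∧
    cdf (μ : Measure ℝ) x ≤ cdf (ν : Measure ℝ) (x + ε) + ε}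

variable {μ ν κ : ProbabilityMeasure ℝ} {ε δ : ℝ}

theorem levy_eq_ofReal_sInf_levySet (μ ν : ProbabilityMeasure ℝ) :
    levy μ ν = ENNReal.ofReal (sInf (levySet μ ν)) := rfl

theorem mem_levySet_iff : ε ∈ levySet μ ν ↔ 0 < ε ∧
    (∀ x, cdf (μ : Measure ℝ) x ≤ cdf (ν : Measure ℝ) (x + ε) + ε) ∧
    ∀ x, cdf (ν : Measure ℝ) x ≤ cdf (μ : Measure ℝ) (x + ε) + ε := by
  refine and_congr_right fun _ => (forall_and.trans and_comm).trans (and_congr_right fun _ => ?_)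
  exact (Equiv.subRight ε).forall_congr fun x => by simp [add_comm]

theorem levySet_comm (μ ν : ProbabilityMeasure ℝ) : levySet μ ν = levySet ν μ := by
  ext ε
  simp only [mem_levySet_iff, and_comm (a := ∀ x, cdf (μ : Measure ℝ) x ≤ _)]

theorem bddBelow_levySet (μ ν : ProbabilityMeasure ℝ) : BddBelow (levySet μ ν) :=
  ⟨0, fun _ h => h.1.le⟩

theorem levySet_nonempty (μ ν : ProbabilityMeasure ℝ) : (levySet μ ν).Nonempty :=
  ⟨1, mem_levySet_iff.2 ⟨one_pos,
    fun _ => (cdf_le_one _ _).trans (le_add_of_nonneg_left (cdf_nonneg _ _)),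
    fun _ => (cdf_le_one _ _).trans (le_add_of_nonneg_left (cdf_nonneg _ _))⟩⟩

theorem mem_levySet_of_le (hε : ε ∈ levySet μ ν) (hεδ : ε ≤ δ) : δ ∈ levySet μ ν := by
  obtain ⟨hε0, hμν, hνμ⟩ := mem_levySet_iff.1 hε
  refine mem_levySet_iff.2 ⟨hε0.trans_le hεδ, fun x => ?_, fun x => ?_⟩
  · grw [hμν x, monotone_cdf (ν : Measure ℝ) (add_le_add_right hεδ x), hεδ]
  · grw [hνμ x, monotone_cdf (μ : Measure ℝ) (add_le_add_right hεδ x), hεδ]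

theorem add_mem_levySet (hε : ε ∈ levySet μ ν) (hδ : δ ∈ levySet ν κ) :
    ε + δ ∈ levySet μ κ := by
  obtain ⟨hε0, hμν, hνμ⟩ := mem_levySet_iff.1 hε
  obtain ⟨hδ0, hνκ, hκν⟩ := mem_levySet_iff.1 hδ
  refine mem_levySet_iff.2 ⟨add_pos hε0 hδ0, fun x => ?_, fun x => ?_⟩
  · grw [hμν x, hνκ (x + ε)]
    exact le_of_eq (by ring_nf)
  · grw [hκν x, hνμ (x + δ)]
    exact le_of_eq (by ring_nf)

theorem levy_le_of_mem_levySet (hε : ε ∈ levySet μ ν) : levy μ ν ≤ ENNReal.ofReal ε :=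
  ENNReal.ofReal_le_ofReal (csInf_le (bddBelow_levySet μ ν) hε)

theorem mem_levySet_of_levy_lt (h : levy μ ν < ENNReal.ofReal ε) : ε ∈ levySet μ ν := by
  obtain ⟨δ, hδ, hδε⟩ := exists_lt_of_csInf_lt (levySet_nonempty μ ν)
    (ENNReal.ofReal_lt_ofReal_iff'.1 h).1
  exact mem_levySet_of_le hδ hδε.le

theorem levy_comm (μ ν : ProbabilityMeasure ℝ) : levy μ ν = levy ν μ := by
  rw [levy_eq_ofReal_sInf_levySet, levySet_comm, levy_eq_ofReal_sInf_levySet]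

open scoped Pointwise in
theorem levy_triangle (μ ν κ : ProbabilityMeasure ℝ) : levy μ κ ≤ levy μ ν + levy ν κ := by
  have sInf_nonneg (μ ν : ProbabilityMeasure ℝ) : 0 ≤ sInf (levySet μ ν) :=
    Real.sInf_nonneg fun _ h => h.1.le
  have add_subset : levySet μ ν + levySet ν κ ⊆ levySet μ κ :=
    Set.add_subset_iff.2 fun _ hε _ hδ => add_mem_levySet hε hδ
  simp only [levy_eq_ofReal_sInf_levySet]
  rw [← ENNReal.ofReal_add (sInf_nonneg _ _) (sInf_nonneg _ _),
    ← csInf_add (levySet_nonempty μ ν) (bddBelow_levySet μ ν) (levySet_nonempty ν κ)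
      (bddBelow_levySet ν κ)]
  exact ENNReal.ofReal_le_ofReal <| csInf_le_csInf (bddBelow_levySet μ κ)
    ((levySet_nonempty μ ν).add (levySet_nonempty ν κ)) add_subset

theorem cdf_le_of_prokhorov_lt (h : prokhorov μ ν < ENNReal.ofReal ε) (x : ℝ) :
    cdf (μ : Measure ℝ) x ≤ cdf (ν : Measure ℝ) (x + ε) + ε := by
  have hε : 0 < ε := ENNReal.ofReal_pos.1 (bot_le.trans_lt h)
  have thickening_subset : Metric.thickening ε (Set.Iic x) ⊆ Set.Iic (x + ε) := by
    intro y hy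
    obtain ⟨z, hz, hyz⟩ := Metric.mem_thickening_iff.1 hy
    rw [Real.dist_eq] at hyz
    exact Set.mem_Iic.2 (by linarith [Set.mem_Iic.1 hz, (abs_lt.1 hyz).2])
  rw [← ENNReal.ofReal_le_ofReal_iff (add_nonneg (cdf_nonneg _ _) hε.le),
    ENNReal.ofReal_add (cdf_nonneg _ _) hε.le, ofReal_cdf, ofReal_cdf]
  grw [measure_le_of_prokhorov_lt h measurableSet_Iic, thickening_subset]

theorem levy_le_prokhorov (μ ν : ProbabilityMeasure ℝ) : levy μ ν ≤ prokhorov μ ν :=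
  le_of_forall_lt_ofReal fun _ hε => levy_le_of_mem_levySet <| mem_levySet_iff.2
    ⟨ENNReal.ofReal_pos.1 (bot_le.trans_lt hε), cdf_le_of_prokhorov_lt hε,
      cdf_le_of_prokhorov_lt (prokhorov_comm μ ν ▸ hε)⟩

theorem exists_Ioc_mem_nhds_subset {α : Type*} [LinearOrder α] [TopologicalSpace α]
    [OrderTopology α] [DenselyOrdered α] [NoMinOrder α] [NoMaxOrder α] {C : Set α} (hC : Dense C)
    {x : α} {u : Set α} (hu : u ∈ 𝓝 x) :
    ∃ a ∈ C, ∃ b ∈ C, a < b ∧ Set.Ioc a b ∈ 𝓝 x ∧ Set.Ioc a b ⊆ u := by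
  obtain ⟨l, r, ⟨hlx, hxr⟩, hlr⟩ := mem_nhds_iff_exists_Ioo_subset.1 hu
  obtain ⟨a, ha, hla, hax⟩ := hC.exists_between hlx
  obtain ⟨b, hb, hxb, hbr⟩ := hC.exists_between hxr
  exact ⟨a, ha, b, hb, hax.trans hxb, Ioc_mem_nhds hax hxb,
    fun y hy => hlr ⟨hla.trans hy.1, hy.2.trans_lt hbr⟩⟩

theorem measureReal_Ioc_eq_cdf_sub (μ : ProbabilityMeasure ℝ) {a b : ℝ} (hab : a ≤ b) :
    (μ : Measure ℝ).real (Set.Ioc a b) = cdf (μ : Measure ℝ) b - cdf (μ : Measure ℝ) a := by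
  rw [cdf_eq_real, cdf_eq_real, ← Set.Iic_sdiff_Iic,
    measureReal_sdiff (Set.Iic_subset_Iic.2 hab) measurableSet_Iic]

theorem tendsto_of_tendsto_cdf {μ : ℕ → ProbabilityMeasure ℝ}
    (h : ∀ x, ContinuousAt (cdf (ν : Measure ℝ)) x →
      Tendsto (fun n => cdf (μ n : Measure ℝ) x) atTop (𝓝 (cdf (ν : Measure ℝ) x))) :
    Tendsto μ atTop (𝓝 ν) := by
  let C : Set ℝ := {x | ContinuousAt (cdf (ν : Measure ℝ)) x}
  have hC : Dense C := by
    simpa only [Set.compl_ofPred, not_not] using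
      (monotone_cdf (ν : Measure ℝ)).countable_not_continuousAt.dense_compl ℝ
  refine (isPiSystem_Ioc_mem C C).tendsto_probabilityMeasure_of_tendsto_of_mem ?_ ?_ ?_
  · rintro _ ⟨a, _, b, _, _, rfl⟩
    exact measurableSet_Ioc
  · intro u hu x hx
    obtain ⟨a, ha, b, hb, hab, hx, hsub⟩ := exists_Ioc_mem_nhds_subset hC (hu.mem_nhds hx)
    exact ⟨_, ⟨a, ha, b, hb, hab, rfl⟩, hx, hsub⟩
  · rintro _ ⟨a, ha, b, hb, hab, rfl⟩
    refine NNReal.tendsto_coe.1 (?_ : Tendsto (fun n => (μ n : Measure ℝ).real (Set.Ioc a b)) atTop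
      (𝓝 ((ν : Measure ℝ).real (Set.Ioc a b))))
    simp only [measureReal_Ioc_eq_cdf_sub _ hab.le]
    exact (h b hb).sub (h a ha)

theorem abs_cdf_sub_le_of_mem_levySet {x η : ℝ} (hε : ε ∈ levySet μ ν)
    (hη : ∀ y, |y - x| ≤ ε → |cdf (ν : Measure ℝ) y - cdf (ν : Measure ℝ) x| ≤ η) :
    |cdf (μ : Measure ℝ) x - cdf (ν : Measure ℝ) x| ≤ η + ε := by
  have hleft := abs_le.1 (hη (x - ε) (by simp [abs_of_pos hε.1]))
  have hright := abs_le.1 (hη (x + ε) (by simp [abs_of_pos hε.1]))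
  rw [abs_le]
  constructor <;> linarith [hε.2 x]

theorem tendsto_cdf_of_tendsto_levy {μ : ℕ → ProbabilityMeasure ℝ}
    (h : Tendsto (fun n => levy (μ n) ν) atTop (𝓝 0)) {x : ℝ}
    (hx : ContinuousAt (cdf (ν : Measure ℝ)) x) :
    Tendsto (fun n => cdf (μ n : Measure ℝ) x) atTop (𝓝 (cdf (ν : Measure ℝ) x)) := by
  refine Metric.tendsto_nhds.2 fun η hη => ?_
  obtain ⟨δ, hδ, hδη⟩ := Metric.continuousAt_iff.1 hx (η / 2) (half_pos hη)
  obtain ⟨ε, hε, hεmin⟩ := exists_between (lt_min hδ (half_pos hη))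
  obtain ⟨hεδ, hεη⟩ := lt_min_iff.1 hεmin
  filter_upwards [h.eventually_lt_const (ENNReal.ofReal_pos.2 hε)] with n hn
  calc |cdf (μ n : Measure ℝ) x - cdf (ν : Measure ℝ) x|
      ≤ η / 2 + ε := abs_cdf_sub_le_of_mem_levySet (mem_levySet_of_levy_lt hn) fun y hy =>
        (hδη (hy.trans_lt hεδ)).le
    _ < η := by linarith

theorem impliesWeak_levy : ImpliesWeak levy :=
  fun _ _ h => tendsto_of_tendsto_cdf fun _ hx => tendsto_cdf_of_tendsto_levy h hx

theorem metrizesWeakAt_levy (ν : ProbabilityMeasure ℝ) : MetrizesWeakAt levy ν :=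
  (metrizesWeakAt_prokhorov ν).of_le_comp impliesWeak_levy tendsto_id (levy_le_prokhorov · ν)

theorem metrizesWeak_levy : MetrizesWeak levy :=
  .of_metrizesWeakAt (fun _ _ => ENNReal.ofReal_ne_top) levy_comm levy_triangle metrizesWeakAt_levy

end Levy

section Kolmogorov

variable {μ ν : ProbabilityMeasure ℝ}

theorem ofReal_abs_cdf_sub_le_kolmogorov (μ ν : ProbabilityMeasure ℝ) (x : ℝ) :
    ENNReal.ofReal |cdf (μ : Measure ℝ) x - cdf (ν : Measure ℝ) x| ≤ kolmogorov μ ν :=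
  le_iSup (fun x : ℝ => ENNReal.ofReal |cdf (μ : Measure ℝ) x - cdf (ν : Measure ℝ) x|) x

theorem levy_le_kolmogorov (μ ν : ProbabilityMeasure ℝ) : levy μ ν ≤ kolmogorov μ ν := by
  refine le_of_forall_lt_ofReal fun ε hε => levy_le_of_mem_levySet ?_
  have hε0 : 0 < ε := ENNReal.ofReal_pos.1 (bot_le.trans_lt hε)
  refine ⟨hε0, fun x => ?_⟩
  have hx : |cdf (μ : Measure ℝ) x - cdf (ν : Measure ℝ) x| < ε :=
    (ENNReal.ofReal_lt_ofReal_iff hε0).1 ((ofReal_abs_cdf_sub_le_kolmogorov μ ν x).trans_lt hε)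
  have hleft := monotone_cdf (ν : Measure ℝ) (sub_le_self x hε0.le)
  have hright := monotone_cdf (ν : Measure ℝ) (le_add_of_nonneg_right hε0.le : x ≤ x + ε)
  constructor <;> linarith [abs_lt.1 hx]

theorem impliesWeak_kolmogorov : ImpliesWeak kolmogorov :=
  impliesWeak_levy.mono levy_le_kolmogorov

theorem tendsto_measureReal_Icc_atBot (μ : ProbabilityMeasure ℝ) (b : ℝ) :
    Tendsto (fun a => (μ : Measure ℝ).real (Set.Icc a b)) atBot (𝓝 (cdf (μ : Measure ℝ) b)) := by
  have tendsto_Ioc : Tendsto (fun a => (μ : Measure ℝ).real (Set.Ioc a b)) atBot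
      (𝓝 (cdf (μ : Measure ℝ) b)) := by
    rw [cdf_eq_real]
    exact (ENNReal.tendsto_toReal (measure_ne_top _ _)).comp (tendsto_measure_Ioc_atBot _ b)
  refine tendsto_of_tendsto_of_tendsto_of_le_of_le tendsto_Ioc tendsto_const_nhds
    (fun a => measureReal_mono Set.Ioc_subset_Icc_self) fun a => ?_
  rw [cdf_eq_real]
  exact measureReal_mono Set.Icc_subset_Iic_self

theorem kolmogorov_le_discrepancy (μ ν : ProbabilityMeasure ℝ) :
    kolmogorov μ ν ≤ discrepancy μ ν := by
  refine iSup_le fun b => le_of_tendsto (ENNReal.tendsto_ofReal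
    ((tendsto_measureReal_Icc_atBot μ b).sub (tendsto_measureReal_Icc_atBot ν b)).abs) ?_
  filter_upwards [eventually_le_atBot b] with a hab
  rw [Real.Icc_eq_closedBall]
  exact le_iSup_of_le _ (le_iSup₂_of_le _ (by linarith) le_rfl)

theorem impliesWeak_discrepancy : ImpliesWeak (Ω := ℝ) discrepancy :=
  impliesWeak_kolmogorov.mono kolmogorov_le_discrepancy

theorem tendsto_cdf_nhdsLT (μ : ProbabilityMeasure ℝ) (x : ℝ) :
    Tendsto (cdf (μ : Measure ℝ)) (𝓝[<] x) (𝓝 ((μ : Measure ℝ).real (Set.Iio x))) := by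
  have leftLim_nonneg : 0 ≤ Function.leftLim (cdf (μ : Measure ℝ)) x :=
    (cdf_nonneg _ _).trans ((monotone_cdf _).le_leftLim (sub_one_lt x))
  have measure_Iio : (μ : Measure ℝ) (Set.Iio x) =
      ENNReal.ofReal (Function.leftLim (cdf (μ : Measure ℝ)) x) := by
    simpa only [measure_cdf, sub_zero] using
      (cdf (μ : Measure ℝ)).measure_Iio (tendsto_cdf_atBot _) x
  rw [Measure.real, measure_Iio, ENNReal.toReal_ofReal leftLim_nonneg]
  exact (monotone_cdf _).tendsto_leftLim x

theorem ofReal_abs_measureReal_Iio_sub_le_kolmogorov (μ ν : ProbabilityMeasure ℝ) (x : ℝ) :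
    ENNReal.ofReal |(μ : Measure ℝ).real (Set.Iio x) - (ν : Measure ℝ).real (Set.Iio x)| ≤
      kolmogorov μ ν :=
  le_of_tendsto
    (ENNReal.tendsto_ofReal ((tendsto_cdf_nhdsLT μ x).sub (tendsto_cdf_nhdsLT ν x)).abs)
    (.of_forall (ofReal_abs_cdf_sub_le_kolmogorov μ ν))

theorem discrepancy_le_two_mul_kolmogorov (μ ν : ProbabilityMeasure ℝ) :
    discrepancy μ ν ≤ 2 * kolmogorov μ ν := by
  refine iSup_le fun x => iSup₂_le fun r hr => ?_
  have measureReal_closedBall (ρ : ProbabilityMeasure ℝ) :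
      (ρ : Measure ℝ).real (Metric.closedBall x r) =
        cdf (ρ : Measure ℝ) (x + r) - (ρ : Measure ℝ).real (Set.Iio (x - r)) := by
    rw [Real.closedBall_eq_Icc, ← Set.Iic_sdiff_Iio, cdf_eq_real,
      measureReal_sdiff (Set.Iio_subset_Iic (by linarith)) measurableSet_Iio]
  rw [measureReal_closedBall, measureReal_closedBall, sub_sub_sub_comm, two_mul]
  grw [abs_sub, ENNReal.ofReal_add_le, ofReal_abs_cdf_sub_le_kolmogorov,
    ofReal_abs_measureReal_Iio_sub_le_kolmogorov]

theorem uniformContinuous_of_tendsto_atBot_of_tendsto_atTop {E : Type*}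
    [SeminormedAddCommGroup E] [NormedSpace ℝ E] {f : ℝ → E} {a b : E} (hf : Continuous f)
    (ha : Tendsto f atBot (𝓝 a)) (hb : Tendsto f atTop (𝓝 b)) : UniformContinuous f := by
  let step (x : ℝ) : E := a + max 0 (min x 1) • (b - a)
  have hstep : UniformContinuous step :=
    uniformContinuous_const.add <|
      (ContinuousLinearMap.toSpanSingleton ℝ (b - a)).uniformContinuous.comp
        ((LipschitzWith.id.min_const 1).const_max 0).uniformContinuous
  have hsub : UniformContinuous (f - step) := by
    refine (hf.sub hstep.continuous).uniformContinuous_of_tendsto_cocompact (x := 0) ?_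
    rw [cocompact_eq_atBot_atTop, tendsto_sup]
    constructor
    · refine (sub_self a ▸ ha.sub_const a).congr' ?_
      filter_upwards [eventually_le_atBot 0] with x hx
      simp [step, hx.trans zero_le_one, hx]
    · refine (sub_self b ▸ hb.sub_const b).congr' ?_
      filter_upwards [eventually_ge_atTop 1] with x hx
      simp [step, hx]
  simpa using hsub.add hstep

theorem continuous_cdf (ν : ProbabilityMeasure ℝ) [NullSingletonClass (ν : Measure ℝ)] :
    Continuous (cdf (ν : Measure ℝ)) := by
  refine continuous_iff_continuousAt.2 fun x => continuousAt_iff_continuous_left'_right'.2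
    ⟨?_, ((cdf (ν : Measure ℝ)).right_continuous x).mono Set.Ioi_subset_Ici_self⟩
  rw [ContinuousWithinAt, cdf_eq_real, ← measureReal_congr Iio_ae_eq_Iic]
  exact tendsto_cdf_nhdsLT ν x

theorem uniformContinuous_cdf (ν : ProbabilityMeasure ℝ) [NullSingletonClass (ν : Measure ℝ)] :
    UniformContinuous (cdf (ν : Measure ℝ)) :=
  uniformContinuous_of_tendsto_atBot_of_tendsto_atTop (continuous_cdf ν) (tendsto_cdf_atBot _)
    (tendsto_cdf_atTop _)

theorem metrizesWeakAt_kolmogorov (ν : ProbabilityMeasure ℝ) [NullSingletonClass (ν : Measure ℝ)] :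
    MetrizesWeakAt kolmogorov ν := by
  refine fun μ => ⟨fun hμ => ENNReal.tendsto_nhds_zero.2 fun c hc => ?_,
    impliesWeak_kolmogorov μ ν⟩
  obtain ⟨η, -, hη, hηc⟩ := ENNReal.lt_iff_exists_real_btwn.1 hc
  rw [ENNReal.ofReal_pos] at hη
  obtain ⟨δ, hδ, hδη⟩ := Metric.uniformContinuous_iff.1 (uniformContinuous_cdf ν) (η / 2)
    (half_pos hη)
  obtain ⟨ε, hε, hεmin⟩ := exists_between (lt_min hδ (half_pos hη))
  obtain ⟨hεδ, hεη⟩ := lt_min_iff.1 hεmin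
  filter_upwards [((metrizesWeakAt_levy ν μ).1 hμ).eventually_lt_const (ENNReal.ofReal_pos.2 hε)]
    with n hn
  refine iSup_le fun x => le_trans (ENNReal.ofReal_le_ofReal ?_) hηc.le
  calc |cdf (μ n : Measure ℝ) x - cdf (ν : Measure ℝ) x|
      ≤ η / 2 + ε := abs_cdf_sub_le_of_mem_levySet (mem_levySet_of_levy_lt hn) fun y hy =>
        (hδη (hy.trans_lt hεδ)).le
    _ ≤ η := by linarith

theorem metrizesWeakAt_discrepancy (ν : ProbabilityMeasure ℝ) [NullSingletonClass (ν : Measure ℝ)] :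
    MetrizesWeakAt discrepancy ν :=
  (metrizesWeakAt_kolmogorov ν).of_le_comp impliesWeak_discrepancy
    (tendsto_const_mul_nhds_zero ENNReal.ofNat_ne_top) (discrepancy_le_two_mul_kolmogorov · ν)

end Kolmogorov

end ProbMetric

theorem mainTheorem2_general :
    (ProbMetric.MetrizesWeak ProbMetric.levy ∧
      ProbMetric.ImpliesWeak (Ω := ℝ) ProbMetric.discrepancy ∧
      ProbMetric.ImpliesWeak ProbMetric.kolmogorov ∧
      ∀ ν : ProbabilityMeasure ℝ, NullSingletonClass (ν : Measure ℝ) →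
        ProbMetric.MetrizesWeakAt ProbMetric.discrepancy ν ∧
        ProbMetric.MetrizesWeakAt ProbMetric.kolmogorov ν) ∧
    (∀ (Ω : Type*) [MetricSpace Ω] [MeasurableSpace Ω] [BorelSpace Ω],
      (TopologicalSpace.SeparableSpace Ω →
        ProbMetric.MetrizesWeak (Ω := Ω) ProbMetric.prokhorov) ∧
      ProbMetric.ImpliesWeak (Ω := Ω) ProbMetric.wasserstein ∧
      (BoundedSpace Ω → TopologicalSpace.SeparableSpace Ω →
        ProbMetric.MetrizesWeak (Ω := Ω) ProbMetric.wasserstein) ∧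
      (ProbMetric.ImpliesWeak (Ω := Ω) ProbMetric.totalVariation ∧
        ProbMetric.ImpliesWeak (Ω := Ω) ProbMetric.hellinger ∧
        (Countable Ω →
          ProbMetric.ImpliesWeak (Ω := Ω) ProbMetric.separation ∧
          ProbMetric.ImpliesWeak (Ω := Ω) (fun μ ν => ProbMetric.separation ν μ)) ∧
        ProbMetric.ImpliesWeak (Ω := Ω) ProbMetric.relativeEntropy ∧
        ProbMetric.ImpliesWeak (Ω := Ω) (fun μ ν => ProbMetric.relativeEntropy ν μ) ∧
        ProbMetric.ImpliesWeak (Ω := Ω) ProbMetric.chiSquare ∧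
        ProbMetric.ImpliesWeak (Ω := Ω) (fun μ ν => ProbMetric.chiSquare ν μ)) ∧
      (Finite Ω →
        ProbMetric.MetrizesWeak (Ω := Ω) ProbMetric.totalVariation ∧
        ProbMetric.MetrizesWeak (Ω := Ω) ProbMetric.hellinger)) := by
  open ProbMetric in
  refine ⟨⟨metrizesWeak_levy, impliesWeak_discrepancy, impliesWeak_kolmogorov,
      fun ν _ => ⟨metrizesWeakAt_discrepancy ν, metrizesWeakAt_kolmogorov ν⟩⟩,
    fun Ω _ _ _ => ⟨fun _ => metrizesWeak_prokhorov, impliesWeak_wasserstein,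
      fun _ _ => metrizesWeak_wasserstein,
      ⟨impliesWeak_totalVariation, impliesWeak_hellinger,
        fun _ => ⟨impliesWeak_separation, impliesWeak_separation_swap⟩,
        impliesWeak_relativeEntropy, impliesWeak_relativeEntropy_swap,
        impliesWeak_chiSquare, impliesWeak_chiSquare_swap⟩,
      fun _ => ⟨metrizesWeak_totalVariation, metrizesWeak_hellinger⟩⟩⟩

theorem mainTheorem2 :
    -- measures on the real line
    (ProbMetric.MetrizesWeak ProbMetric.levy ∧
      ProbMetric.ImpliesWeak (Ω := ℝ) ProbMetric.discrepancy ∧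
      ProbMetric.ImpliesWeak ProbMetric.kolmogorov ∧
      ∀ ν : ProbabilityMeasure ℝ, (ν : Measure ℝ) ≪ volume →
        ProbMetric.MetrizesWeakAt ProbMetric.discrepancy ν ∧
        ProbMetric.MetrizesWeakAt ProbMetric.kolmogorov ν) ∧
    -- measures on a metric space
    (∀ (Ω : Type*) [MetricSpace Ω] [MeasurableSpace Ω] [BorelSpace Ω],
      (TopologicalSpace.SeparableSpace Ω →
        ProbMetric.MetrizesWeak (Ω := Ω) ProbMetric.prokhorov) ∧
      ProbMetric.ImpliesWeak (Ω := Ω) ProbMetric.wasserstein ∧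
      -- bounded spaces
      (BoundedSpace Ω →
        (TopologicalSpace.SeparableSpace Ω →
          ProbMetric.MetrizesWeak (Ω := Ω) ProbMetric.wasserstein) ∧
        ProbMetric.ImpliesWeak (Ω := Ω) ProbMetric.totalVariation ∧
        ProbMetric.ImpliesWeak (Ω := Ω) ProbMetric.hellinger ∧
        (Countable Ω →
          ProbMetric.ImpliesWeak (Ω := Ω) ProbMetric.separation ∧
          ProbMetric.ImpliesWeak (Ω := Ω) (fun μ ν => ProbMetric.separation ν μ)) ∧
        ProbMetric.ImpliesWeak (Ω := Ω) ProbMetric.relativeEntropy ∧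
        ProbMetric.ImpliesWeak (Ω := Ω) (fun μ ν => ProbMetric.relativeEntropy ν μ) ∧
        ProbMetric.ImpliesWeak (Ω := Ω) ProbMetric.chiSquare ∧
        ProbMetric.ImpliesWeak (Ω := Ω) (fun μ ν => ProbMetric.chiSquare ν μ)) ∧
      -- bounded and finite spaces
      (BoundedSpace Ω → Finite Ω →
        ProbMetric.MetrizesWeak (Ω := Ω) ProbMetric.totalVariation ∧
        ProbMetric.MetrizesWeak (Ω := Ω) ProbMetric.hellinger)) := by
  obtain ⟨⟨hL, hD, hK, hReal⟩, hΩ⟩ := mainTheorem2_general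
  refine ⟨⟨hL, hD, hK, fun ν hν => hReal ν ⟨fun x => hν Real.volume_singleton⟩⟩, fun Ω _ _ _ => ?_⟩
  obtain ⟨hP, hW, hWmetrizes, hImplies, hFinite⟩ := hΩ Ω
  exact ⟨hP, hW, fun hb => ⟨hWmetrizes hb, hImplies⟩, fun _ => hFinite⟩
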